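/- Let $c, n \ge 1$, let $\mathcal{X} \subset \mathbb{R}^d$, and let $D$ be a probability distribution on $\mathcal{X} \times \{-1,+1\}^c$. Let $\kappa : \mathcal{X} \times \mathcal{X} \to \mathbb{R}$ be a (jointly measurable) positive definite symmetric kernel with a feature map $\phi : \mathcal{X} \to \mathbb{H}$ into a real Hilbert space, i.e. $\kappa(\mathbf{x},\mathbf{x}') = \langle \phi(\mathbf{x}), \phi(\mathbf{x}') \rangle$ (for instance the canonical map into the reproducing kernel Hilbert space of $\kappa$), and suppose $\kappa(\mathbf{x},\mathbf{x}) \le r^2$ for all $\mathbf{x} \in \mathcal{X}$, where $r > 0$. For $\Lambda \ge 0$ let $$\mathcal{F} = \Big\{ \mathbf{x} \mapsto \big(\langle \mathbf{w}_1, \phi(\mathbf{x})\rangle, \ldots, \langle \mathbf{w}_c, \phi(\mathbf{x})\rangle\big) : \mathbf{w}_1,\dots,\mathbf{w}_c \in \mathbb{H},\ \Big(\sum_{j=1}^c \|\mathbf{w}_j\|^2\Big)^{1/2} \le \Lambda \Big\}.$$ Let $\mathrm{sgn}(t) = 1$ if $t > 0$ and $-1$ otherwise. Let $\ell : \mathbb{R}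 \to \mathbb{R}$ be a $\rho$-Lipschitz base loss that upper bounds the $0/1$ loss, i.e. $[\![ \mathrm{sgn}(t) \ne y ]\!] \le \ell(y t)$ for all $t \in \mathbb{R}$, $y \in \{-1,+1\}$, and that is bounded by $B$ on the attainable range: $|\ell(u)| \le B$ whenever $|u| \le \Lambda r$ (this holds in particular if $\ell$ is bounded by $B$ on $\mathbb{R}$). For $f \in \mathcal{F}$ and a sample $S = ((\mathbf{x}_i, \mathbf{y}_i))_{i=1}^n$ put $$R^s_{0/1}(\mathrm{sgn}\circ f) = \mathbb{E}_{(\mathbf{x},\mathbf{y})\sim D} \max_{1 \le j \le c} [\![ \mathrm{sgn}(f_j(\mathbf{x})) \ne y_j ]\!], \qquad R^h_{0/1}(\mathrm{sgn}\circ f) = \mathbb{E}_{(\mathbf{x},\mathbf{y})\sim D} \frac1c \sum_{j=1}^c [\![ \mathrm{sgn}(f_j(\mathbf{x})) \ne y_j ]\!],$$ $$\hat R^h_S(f) = \frac1n \sum_{i=1}^n \frac1c \sum_{j=1}^c \ell\big(y_{ij} f_j(\mathbf{x}_i)\big).$$ Then, for every $\delta > 0$, with probability at least $1-\delta$ over an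 i.i.d. sample $S \sim D^n$, the following holds simultaneously for all $f \in \mathcal{F}$: $$R^s_{0/1}(\mathrm{sgn}\circ f) \ \le\ c\, R^h_{0/1}(\mathrm{sgn}\circ f) \ \le\ c\, \hat R^h_S(f) + 2\sqrt2\, \rho\, c \sqrt{\frac{\Lambda^2 r^2}{n}} + 3 B c \sqrt{\frac{\log(2/\delta)}{2n}}.$$ -/

import Mathlib

open MeasureTheory
open scoped NNReal RealInnerProductSpace

noncomputable section

namespace MultiLabel

/-- The two possible values `-1` and `+1` of a single label, as real numbers. -/
abbrev Label : Type := ↥({-1, 1} : Set ℝ)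

/-- `sgn t` is `1` when `t > 0` and `-1` otherwise (so `sgn 0 = -1`). -/
def sgn (t : ℝ) : Label :=
  if 0 < t then ⟨1, Or.inr rfl⟩ else ⟨-1, Or.inl rfl⟩

/-- The classifier `sgn ∘ f` induced by a score function `f`, with `c` labels. -/
def classifier {X : Type*} {c : ℕ} (f : X → Fin c → ℝ) (x : X) : Fin c → Label :=
  fun j => sgn (f x j)

/-- The Hamming 0/1 loss of a predicted label vector: the fraction of wrong labels. -/
def hammingLoss01 {c : ℕ} (h y : Fin c → Label) : ℝ :=
  (1 / (c : ℝ)) * ∑ j, (if h j ≠ y j then (1 : ℝ) else 0)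

/-- The subset 0/1 loss of a predicted label vector: the maximum over the labels of the
indicator that the label is wrong. -/
def subsetLoss01 {c : ℕ} (h y : Fin c → Label) : ℝ :=
  ⨆ j, (if h j ≠ y j then (1 : ℝ) else 0)

/-- The surrogate Hamming loss of a score vector `v`, with base loss `l`. -/
def hammingLoss {c : ℕ} (l : ℝ → ℝ) (v : Fin c → ℝ) (y : Fin c → Label) : ℝ :=
  (1 / (c : ℝ)) * ∑ j, l ((y j : ℝ) * v j)

/-- The true (expected) Hamming 0/1 risk of a classifier. -/
def hammingRisk01 {X : Type*} [MeasurableSpace X] {c : ℕ}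
    (D : Measure (X × (Fin c → Label))) (h : X → Fin c → Label) : ℝ :=
  ∫ z, hammingLoss01 (h z.1) z.2 ∂D

/-- The true (expected) subset 0/1 risk of a classifier. -/
def subsetRisk01 {X : Type*} [MeasurableSpace X] {c : ℕ}
    (D : Measure (X × (Fin c → Label))) (h : X → Fin c → Label) : ℝ :=
  ∫ z, subsetLoss01 (h z.1) z.2 ∂D

/-- The empirical surrogate Hamming risk of a score function on a sample of size `n`. -/
def empiricalHammingRisk {X : Type*} {c n : ℕ} (l : ℝ → ℝ)
    (S : Fin n → X × (Fin c → Label)) (f : X → Fin c → ℝ) : ℝ :=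
  (1 / (n : ℝ)) * ∑ i, hammingLoss l (f (S i).1) (S i).2

/-- `φ` is a feature map of the kernel `κ` with values in the Hilbert space `H`. Every such
`κ` is symmetric and positive (semi)definite, and the canonical map `x ↦ κ(x, ·)` into the
reproducing kernel Hilbert space of `κ` is such a feature map. -/
def IsFeatureMap {X H : Type*} [NormedAddCommGroup H] [InnerProductSpace ℝ H]
    (κ : X → X → ℝ) (φ : X → H) : Prop :=
  ∀ x x', κ x x' = ⟪φ x, φ x'⟫

/-- The kernel-based hypothesis set: all `x ↦ (⟪w₁, φ x⟫, …, ⟪w_c, φ x⟫)` whose weights satisfy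
`(∑ j, ‖w_j‖²)^(1/2) ≤ Λ`. -/
def hypothesisSet {X H : Type*} [NormedAddCommGroup H] [InnerProductSpace ℝ H]
    (c : ℕ) (φ : X → H) (Λ : ℝ) : Set (X → Fin c → ℝ) :=
  {f | ∃ W : Fin c → H, √(∑ j, ‖W j‖ ^ 2) ≤ Λ ∧ f = fun x j => ⟪W j, φ x⟫}

end MultiLabel

end

namespace MultiLabel

open ProbabilityTheory

/-! The subset loss is a maximum of `c` indicators and `c` times the Hamming loss is their sum,
which gives the first inequality. For the second, the base loss dominates the 0/1 loss, so it
suffices to bound the surrogate Hamming risk uniformly over the weights.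

Absorbing the label into the feature, `ψ_j(x, y) = y_j φ(x)`, turns `l (y_j f_j(x))` into `l ⟪w_j,
ψ_j(x, y)⟫`, and the joint norm constraint puts every `w_j` in the ball of radius `Λ`. The labels
thus decouple into `c` scalar problems. For each, let `U_j(S)` be the largest excess, over that
ball, of true over empirical loss. The surrogate risk exceeds the empirical one by at most the
average of the `U_j`. Symmetrization, contraction and the second moment of a Rademacher sum bound
the mean of each `U_j` by `2ρΛr/√n` (`integral_uniformDeviation_le`). The losses lie in `[0, B]`, so
the average of the `U_j` changes by at most `B/n` when one sample point changes, and McDiarmid's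
inequality adds `B√(log(1/δ)/(2n))`. Both terms are within the claimed ones.

The delicate point is measurability of `U_j`: `H` may be nonseparable and `φ` is controlled only
through the jointly measurable kernel. `measurable_iSup_lossFunctional` replaces the ball by a
countable family of weights depending measurably, in the weak sense, on the sample. -/

lemma integrable_of_abs_le {α : Type*} [MeasurableSpace α] {μ : Measure α} [IsFiniteMeasure μ]
    {f : α → ℝ} (hf : Measurable f) {M : ℝ} (hM : ∀ x, |f x| ≤ M) : Integrable f μ :=
  Integrable.of_bound hf.aestronglyMeasurable M (ae_of_all _ hM)

/-! ### Concentration under bounded differences -/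

/-- McDiarmid's inequality in moment generating function form. -/
theorem hasSubgaussianMGF_pi_of_bounded_differences {Z : Type*} [MeasurableSpace Z]
    (D : Measure Z) [IsProbabilityMeasure D] (c M : ℝ) (n : ℕ) (f : (Fin n → Z) → ℝ)
    (hf : Measurable f) (hM : ∀ S, |f S| ≤ M)
    (hc : ∀ S i z, |f (Function.update S i z) - f S| ≤ c) :
    HasSubgaussianMGF (fun S => f S - ∫ S', f S' ∂(Measure.pi fun _ => D))
      (n * (‖c‖₊ / 2) ^ 2) (Measure.pi fun _ => D) := by
  have hbdd : ∀ S, f S - ∫ S', f S' ∂(Measure.pi fun _ => D) ∈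
      Set.Icc (-M - ∫ S', f S' ∂(Measure.pi fun _ => D))
        (M - ∫ S', f S' ∂(Measure.pi fun _ => D)) := fun S => by
    have := abs_le.1 (hM S)
    constructor <;> linarith
  have hm : Measurable fun S => f S - ∫ S', f S' ∂(Measure.pi fun _ => D) := hf.sub_const _
  refine ⟨fun t => integrable_exp_mul_of_mem_Icc hm.aemeasurable (ae_of_all _ hbdd), fun t => ?_⟩
  induction n with
  | zero =>
    have h0 : ∀ S, f S - ∫ S', f S' ∂(Measure.pi fun _ => D) = 0 := fun S => by
      have : ∀ S', f S' = f S := fun S' => congrArg f (Subsingleton.elim _ _)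
      simp [this]
    simp [mgf, h0]
  | succ n ih =>
    have : Nonempty Z := nonempty_of_isProbabilityMeasure D
    have mp := (measurePreserving_piFinSuccAbove (fun _ : Fin (n + 1) => D) 0).symm
    set e := (MeasurableEquiv.piFinSuccAbove (fun _ : Fin (n + 1) => Z) 0).symm
    have he : ∀ z S, e (z, S) = Fin.cons z S := fun z S => by
      rw [show e (z, S) = Fin.insertNth 0 z S from rfl, Fin.insertNth_zero']
    set P : Measure (Fin n → Z) := Measure.pi fun _ => D
    have hF : Measurable fun p => f (e p) := hf.comp e.measurable
    have hFz : ∀ z, Measurable fun S => f (e (z, S)) := fun z => hF.comp measurable_prodMk_left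
    -- The conditional mean given the first coordinate. In `f - E f = (f - g) + (g - E g)`, the
    -- induction hypothesis controls the first term for each fixed `z`, and Hoeffding's lemma the
    -- second.
    set g : Z → ℝ := fun z => ∫ S, f (e (z, S)) ∂P with hg
    have hgm : Measurable g := hF.stronglyMeasurable.integral_prod_right'.measurable
    have hFint : ∀ z, Integrable (fun S => f (e (z, S))) P := fun z =>
      integrable_of_abs_le (hFz z) fun S => hM _
    have hE : ∫ S, f S ∂(Measure.pi fun _ => D) = ∫ z, g z ∂D := by
      rw [← mp.integral_comp', integral_prod]
      exact integrable_of_abs_le hF fun p => hM _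
    have hgd : ∀ z z', g z - g z' ≤ c := fun z z' => by
      rw [hg]
      simp only
      rw [← integral_sub (hFint z) (hFint z')]
      calc ∫ S, (f (e (z, S)) - f (e (z', S))) ∂P ≤ ∫ S, c ∂P := by
            refine integral_mono ((hFint z).sub (hFint z')) (integrable_const c) fun S => ?_
            have := hc (e (z', S)) 0 z
            rw [he, Fin.update_cons_zero, ← he z, ← he] at this
            exact (le_abs_self _).trans this
        _ = c := by simp
    have hgM : ∀ z, |g z| ≤ M := fun z => by
      refine (norm_integral_le_of_norm_le_const (f := fun S => f (e (z, S))) (C := M)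
        (ae_of_all P fun S => hM (e (z, S)))).trans ?_
      simp
    have hgbdd : BddBelow (Set.range g) := ⟨-M, by
      rintro _ ⟨z, rfl⟩
      exact (abs_le.1 (hgM z)).1⟩
    -- Two values of `g` differ by at most `c`, so its range fits in an interval of length `c`
    -- starting at its infimum; this yields the variance proxy `(‖c‖ / 2) ^ 2`.
    have hH := hasSubgaussianMGF_of_mem_Icc (μ := D) (X := g) (a := ⨅ z, g z) (b := (⨅ z, g z) + c)
      hgm.aemeasurable (ae_of_all _ fun z => ⟨ciInf_le hgbdd z, by
        have : g z - c ≤ ⨅ z, g z := le_ciInf fun z' => by linarith [hgd z z']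
        linarith⟩)
    rw [add_sub_cancel_left] at hH
    have hcond : ∀ z, ∫ S, Real.exp (t * (f (e (z, S)) - g z)) ∂P
        ≤ Real.exp ((n : ℝ) * (‖c‖ / 2) ^ 2 * t ^ 2 / 2) := fun z => by
      have := ih (fun S => f (e (z, S))) (hFz z) (fun S => hM _) (fun S i z' => by
        have := hc (e (z, S)) i.succ z'
        rwa [he, ← Fin.cons_update, ← he, ← he] at this) (fun S => by
          have := abs_le.1 (hM (e (z, S)))
          constructor <;> linarith) ((hFz z).sub_const _)
      simpa [mgf] using this
    have hint : Integrable (fun p : Z × (Fin n → Z) =>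
        Real.exp (t * (f (e p) - ∫ z, g z ∂D))) (D.prod P) := by
      rw [hE] at hbdd hm
      exact integrable_exp_mul_of_mem_Icc (hm.comp e.measurable).aemeasurable
        (ae_of_all _ fun p => hbdd (e p))
    rw [mgf, hE, ← mp.integral_comp', integral_prod _ hint]
    calc ∫ z, ∫ S, Real.exp (t * (f (e (z, S)) - ∫ z, g z ∂D)) ∂P ∂D
        ≤ ∫ z, Real.exp ((n : ℝ) * (‖c‖ / 2) ^ 2 * t ^ 2 / 2)
            * Real.exp (t * (g z - ∫ z, g z ∂D)) ∂D := by
          refine integral_mono hint.integral_prod_left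
            ((hH.integrable_exp_mul t).const_mul _) fun z => ?_
          simp only
          rw [← sub_nonneg]
          have : ∀ S, Real.exp (t * (f (e (z, S)) - ∫ z, g z ∂D))
              = Real.exp (t * (f (e (z, S)) - g z)) * Real.exp (t * (g z - ∫ z, g z ∂D)) :=
            fun S => by rw [← Real.exp_add]; ring_nf
          simp_rw [this, integral_mul_const]
          rw [← sub_mul]
          exact mul_nonneg (sub_nonneg.2 (hcond z)) (Real.exp_pos _).le
      _ = Real.exp ((n : ℝ) * (‖c‖ / 2) ^ 2 * t ^ 2 / 2)
            * mgf (fun z => g z - ∫ z, g z ∂D) D t := by rw [integral_const_mul, mgf]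
      _ ≤ Real.exp ((n : ℝ) * (‖c‖ / 2) ^ 2 * t ^ 2 / 2)
            * Real.exp ((‖c‖ / 2) ^ 2 * t ^ 2 / 2) := by
          gcongr
          simpa using hH.mgf_le t
      _ = _ := by
          rw [← Real.exp_add]
          push_cast
          ring_nf

lemma bddAbove_range_of_abs_le {T : Type*} {f : T → ℝ} {M : ℝ} (hM : ∀ t, |f t| ≤ M) :
    BddAbove (Set.range f) :=
  ⟨M, by rintro _ ⟨t, rfl⟩; exact (abs_le.1 (hM t)).2⟩

/-! ### Rademacher averages and contraction -/

/-- The real number `1` or `-1` encoded by a Boolean. -/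
def sign (b : Bool) : ℝ := if b then 1 else -1

@[simp] lemma sign_true : sign true = 1 := rfl
@[simp] lemma sign_false : sign false = -1 := rfl
@[simp] lemma abs_sign (b : Bool) : |sign b| = 1 := by cases b <;> simp

lemma sum_bool_cons {n : ℕ} (F : (Fin (n + 1) → Bool) → ℝ) :
    ∑ ε, F ε = ∑ ε : Fin n → Bool, (F (Fin.cons true ε) + F (Fin.cons false ε)) := by
  rw [← (Fin.consEquiv fun _ : Fin (n + 1) => Bool).sum_comp, Fintype.sum_prod_type_right]
  simp only [Fintype.sum_bool]
  rfl

lemma sum_sign_not {n : ℕ} (F : (Fin n → Bool) → ℝ) :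
    ∑ ε : Fin n → Bool, F (fun i => !ε i) = ∑ ε, F ε :=
  (Equiv.piCongrRight fun _ : Fin n => Equiv.boolNot).sum_comp F

/-- One coordinate of the contraction principle. For a pair `t, t'` the `φ`-difference is at most
`|a t - a t'|`, and whichever sign opens this absolute value, one of the two points can be charged
to the supremum with `+ a` and the other to the one with `- a`. -/
lemma iSup_add_add_iSup_sub_le {T : Type*} [Nonempty T] {g φ a : T → ℝ} {G A : ℝ}
    (hg : ∀ t, |g t| ≤ G) (ha : ∀ t, |a t| ≤ A)
    (h : ∀ t t', |φ t - φ t'| ≤ |a t - a t'|) :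
    (⨆ t, (g t + φ t)) + (⨆ t, (g t - φ t)) ≤ (⨆ t, (g t + a t)) + (⨆ t, (g t - a t)) := by
  have b1 : BddAbove (Set.range fun t => g t + a t) :=
    bddAbove_range_of_abs_le (M := G + A) fun t =>
      (abs_add_le _ _).trans (add_le_add (hg t) (ha t))
  have b2 : BddAbove (Set.range fun t => g t - a t) :=
    bddAbove_range_of_abs_le (M := G + A) fun t => (abs_sub _ _).trans (add_le_add (hg t) (ha t))
  have key : ∀ t t', (g t + φ t) + (g t' - φ t') ≤
      (⨆ t, (g t + a t)) + (⨆ t, (g t - a t)) := fun t t' => by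
    have h1 := (le_abs_self _).trans (h t t')
    have u1 := le_ciSup b1
    have u2 := le_ciSup b2
    rcases abs_cases (a t - a t') with ⟨e, -⟩ | ⟨e, -⟩
    · linarith [u1 t, u2 t']
    · linarith [u1 t', u2 t]
  have : (⨆ t, (g t + φ t)) ≤ (⨆ t, (g t + a t)) + (⨆ t, (g t - a t)) - (⨆ t, (g t - φ t)) :=
    ciSup_le fun t => by
      have : (⨆ t, (g t - φ t)) ≤ (⨆ t, (g t + a t)) + (⨆ t, (g t - a t)) - (g t + φ t) :=
        ciSup_le fun t' => by linarith [key t t']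
      linarith
  linarith

/-- The Ledoux–Talagrand contraction principle. -/
theorem sum_iSup_le_sum_iSup_of_contraction {T : Type*} [Nonempty T] (n : ℕ)
    (φ a : Fin n → T → ℝ) (Φ A : ℝ) (hφ : ∀ i t, |φ i t| ≤ Φ) (ha : ∀ i t, |a i t| ≤ A)
    (h : ∀ i t t', |φ i t - φ i t'| ≤ |a i t - a i t'|)
    (g : T → ℝ) (G : ℝ) (hg : ∀ t, |g t| ≤ G) :
    ∑ ε : Fin n → Bool, ⨆ t, (g t + ∑ i, sign (ε i) * φ i t) ≤
      ∑ ε : Fin n → Bool, ⨆ t, (g t + ∑ i, sign (ε i) * a i t) := by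
  induction n generalizing g G with
  | zero => simp
  | succ n ih =>
    -- With the first sign fixed, its term is absorbed into the offset `g`, so the induction
    -- hypothesis replaces all the later `φ i` by `a i`. The first coordinate is then replaced by
    -- pairing its two signs.
    have step : ∀ b : Bool, ∑ ε : Fin n → Bool,
        (⨆ t, (g t + ∑ i, sign ((Fin.cons b ε : Fin (n + 1) → Bool) i) * φ i t)) ≤
        ∑ ε : Fin n → Bool,
          ⨆ t, ((g t + ∑ i, sign (ε i) * a i.succ t) + sign b * φ 0 t) := fun b => by
      have := ih (fun i => φ i.succ) (fun i => a i.succ) (fun i => hφ _) (fun i => ha _)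
        (fun i => h _) (fun t => g t + sign b * φ 0 t) (G + Φ) fun t => by
          refine (abs_add_le _ _).trans (add_le_add (hg t) ?_)
          rw [abs_mul, abs_sign, one_mul]
          exact hφ 0 t
      simp only [Fin.sum_univ_succ, Fin.cons_zero, Fin.cons_succ, ← add_assoc]
      refine this.trans_eq (Finset.sum_congr rfl fun ε _ => iSup_congr fun t => by ring)
    rw [sum_bool_cons, Finset.sum_add_distrib]
    refine (add_le_add (step true) (step false)).trans ?_
    rw [sum_bool_cons, ← Finset.sum_add_distrib]
    refine Finset.sum_le_sum fun ε _ => ?_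
    have := iSup_add_add_iSup_sub_le (g := fun t => g t + ∑ i, sign (ε i) * a i.succ t)
      (φ := φ 0) (a := a 0) (G := G + ∑ _i : Fin n, A) (fun t => by
        refine (abs_add_le _ _).trans (add_le_add (hg t) ?_)
        refine (Finset.abs_sum_le_sum_abs _ _).trans (Finset.sum_le_sum fun i _ => ?_)
        rw [abs_mul, abs_sign, one_mul]
        exact ha _ t) (ha 0) (h 0)
    simp only [sign_true, sign_false, one_mul, neg_one_mul, Fin.sum_univ_succ, Fin.cons_zero,
      Fin.cons_succ, ← sub_eq_add_neg]
    refine this.trans_eq ?_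
    congr 1 <;> refine iSup_congr fun t => by ring

/-- Cross terms cancel over the two values of each sign, by the parallelogram law. The offset `u`
carries the vectors already added in the induction. -/
lemma sum_norm_add_sum_sign_sq {H : Type*} [NormedAddCommGroup H] [InnerProductSpace ℝ H]
    (n : ℕ) (v : Fin n → H) (u : H) :
    ∑ ε : Fin n → Bool, ‖u + ∑ i, sign (ε i) • v i‖ ^ 2 = 2 ^ n * (‖u‖ ^ 2 + ∑ i, ‖v i‖ ^ 2) := by
  induction n generalizing u with
  | zero => simp
  | succ n ih =>
    rw [sum_bool_cons]
    simp only [Fin.sum_univ_succ, Fin.cons_zero, Fin.cons_succ, ← add_assoc, Finset.sum_add_distrib,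
      ih, sign_true, sign_false, one_smul, neg_one_smul, ← sub_eq_add_neg]
    have := parallelogram_law_with_norm ℝ u (v 0)
    rw [pow_succ]
    linear_combination (2 : ℝ) ^ n * this

/-- Cauchy–Schwarz over the `2 ^ n` sign patterns passes from first to second moments. -/
lemma sum_norm_sum_sign_le {H : Type*} [NormedAddCommGroup H] [InnerProductSpace ℝ H]
    {n : ℕ} (v : Fin n → H) :
    ∑ ε : Fin n → Bool, ‖∑ i, sign (ε i) • v i‖ ≤ 2 ^ n * √(∑ i, ‖v i‖ ^ 2) := by
  have h1 := sum_norm_add_sum_sign_sq n v 0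
  have h2 := sq_sum_le_card_mul_sum_sq (s := (Finset.univ : Finset (Fin n → Bool)))
    (f := fun ε => ‖∑ i, sign (ε i) • v i‖)
  simp only [zero_add, norm_zero, ne_eq, OfNat.ofNat_ne_zero, not_false_eq_true, zero_pow] at h1
  rw [h1] at h2
  refine (Real.le_sqrt_of_sq_le h2).trans_eq ?_
  simp only [Finset.card_univ, Fintype.card_pi, Fintype.card_bool, Finset.prod_const,
    Fintype.card_fin, Nat.cast_pow, Nat.cast_ofNat]
  rw [← mul_assoc, ← sq, Real.sqrt_mul (by positivity), Real.sqrt_sq (by positivity)]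

/-- The Rademacher complexity bound for Lipschitz functions of linear functionals in a ball. -/
theorem sum_iSup_sign_lipschitz_le {H : Type*} [NormedAddCommGroup H] [InnerProductSpace ℝ H]
    {n : ℕ} (v : Fin n → H) {Λ r : ℝ} (hΛ : 0 ≤ Λ) (hr : 0 ≤ r) (hv : ∀ i, ‖v i‖ ≤ r)
    {l : ℝ → ℝ} {ρ : ℝ≥0} (hl : LipschitzWith ρ l) :
    ∑ ε : Fin n → Bool, ⨆ w : Metric.closedBall (0 : H) Λ, ∑ i, sign (ε i) * l ⟪(w : H), v i⟫ ≤
      2 ^ n * (ρ * Λ * r * √n) := by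
  have : Nonempty (Metric.closedBall (0 : H) Λ) := ⟨⟨0, Metric.mem_closedBall_self hΛ⟩⟩
  have hw : ∀ w : Metric.closedBall (0 : H) Λ, ‖(w : H)‖ ≤ Λ := fun w =>
    mem_closedBall_zero_iff.1 w.2
  have hin : ∀ (w : Metric.closedBall (0 : H) Λ) i, |⟪(w : H), v i⟫| ≤ Λ * r := fun w i =>
    (abs_real_inner_le_norm _ _).trans (mul_le_mul (hw w) (hv i) (norm_nonneg _) hΛ)
  have h1 := sum_iSup_le_sum_iSup_of_contraction n
    (fun i (w : Metric.closedBall (0 : H) Λ) => l ⟪(w : H), v i⟫)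
    (fun i w => ρ * ⟪(w : H), v i⟫) (|l 0| + ρ * (Λ * r)) (ρ * (Λ * r))
    (fun i w => by
      have := hl.dist_le_mul ⟪(w : H), v i⟫ 0
      rw [Real.dist_eq, Real.dist_eq, sub_zero] at this
      have h2 := abs_sub_abs_le_abs_sub (l ⟪(w : H), v i⟫) (l 0)
      have := this.trans (mul_le_mul_of_nonneg_left (hin w i) ρ.2)
      linarith)
    (fun i w => by
      rw [abs_mul, NNReal.abs_eq]
      exact mul_le_mul_of_nonneg_left (hin w i) ρ.2)
    (fun i w w' => by
      rw [← mul_sub, abs_mul, NNReal.abs_eq]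
      exact hl.dist_le_mul _ _)
    (fun _ => 0) 0 (fun _ => by simp)
  simp only [zero_add] at h1
  refine h1.trans ?_
  -- After contraction the functional is linear in `w`, so Cauchy–Schwarz evaluates the supremum
  -- over the ball.
  have h2 : ∀ ε : Fin n → Bool, (⨆ w : Metric.closedBall (0 : H) Λ,
      ∑ i, sign (ε i) * (ρ * ⟪(w : H), v i⟫)) ≤ ρ * Λ * ‖∑ i, sign (ε i) • v i‖ := fun ε => by
    refine ciSup_le fun w => ?_
    have : ∑ i, sign (ε i) * (ρ * ⟪(w : H), v i⟫) = ρ * ⟪(w : H), ∑ i, sign (ε i) • v i⟫ := by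
      rw [inner_sum, Finset.mul_sum]
      exact Finset.sum_congr rfl fun i _ => by rw [real_inner_smul_right]; ring
    rw [this, mul_assoc]
    gcongr
    exact (real_inner_le_norm _ _).trans (mul_le_mul_of_nonneg_right (hw w) (norm_nonneg _))
  refine (Finset.sum_le_sum fun ε _ => h2 ε).trans ?_
  rw [← Finset.mul_sum]
  refine (mul_le_mul_of_nonneg_left (sum_norm_sum_sign_le v) (by positivity)).trans ?_
  have h3 : √(∑ i, ‖v i‖ ^ 2) ≤ r * √n := by
    rw [Real.sqrt_le_left (by positivity), mul_pow, Real.sq_sqrt (by positivity)]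
    refine (Finset.sum_le_sum fun i _ => pow_le_pow_left₀ (norm_nonneg _) (hv i) 2).trans_eq ?_
    simp [mul_comm]
  calc ρ * Λ * (2 ^ n * √(∑ i, ‖v i‖ ^ 2)) ≤ ρ * Λ * (2 ^ n * (r * √n)) := by gcongr
    _ = _ := by ring

/-! ### Measurability of the suprema, without separability -/

open TopologicalSpace

section FeatureMap

variable {Z H : Type*} [MeasurableSpace Z] [NormedAddCommGroup H] [InnerProductSpace ℝ H]
  [CompleteSpace H] {ψ : Z → H}

/-- A feature map of a jointly measurable kernel is weakly measurable. -/
theorem measurable_inner_featureMap (hψ : Measurable fun p : Z × Z => ⟪ψ p.1, ψ p.2⟫) (w : H) :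
    Measurable fun z => ⟪w, ψ z⟫ := by
  -- The directions with measurable pairing form a closed subspace, which contains every `ψ z` by
  -- joint measurability. The part of `w` orthogonal to it pairs to zero with all `ψ z`, so
  -- projecting `w` changes nothing.
  let K : Submodule ℝ H :=
    { carrier := {w | Measurable fun z => ⟪w, ψ z⟫}
      add_mem' := fun {a b} ha hb => by
        simp only [Set.mem_ofPred_eq, inner_add_left]
        exact Measurable.add ha hb
      zero_mem' := by simp
      smul_mem' := fun c a ha => by
        simp only [Set.mem_ofPred_eq, real_inner_smul_left]
        exact Measurable.const_mul ha c }
  have hK : IsClosed (K : Set H) := by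
    refine IsSeqClosed.isClosed fun u x hu hx => ?_
    refine measurable_of_tendsto_metrizable (f := fun n z => ⟪u n, ψ z⟫) hu ?_
    exact tendsto_pi_nhds.2 fun z => hx.inner tendsto_const_nhds
  have : CompleteSpace K := hK.completeSpace_coe
  have hmem : ∀ z, ψ z ∈ K := fun z => hψ.comp measurable_prodMk_left
  have h1 : Measurable fun z => ⟪K.starProjection w, ψ z⟫ := K.starProjection_apply_mem w
  convert h1 using 2 with z
  have := K.sub_starProjection_mem_orthogonal w
  have := (Submodule.mem_orthogonal' K _).1 this (ψ z) (hmem z)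
  rw [inner_sub_left] at this
  linarith

/-- All but countably many directions of a Hilbert basis are almost surely orthogonal to a
bounded weakly measurable map. -/
theorem exists_countable_forall_ae_inner_eq_zero (D : Measure Z) [IsProbabilityMeasure D]
    (hψ : ∀ w, Measurable fun z => ⟪w, ψ z⟫) {r : ℝ} (hr : ∀ z, ‖ψ z‖ ≤ r) :
    ∃ C : Set H, C.Countable ∧
      ∀ w, (∀ e ∈ C, ⟪w, e⟫ = 0) → ∀ᵐ z ∂D, ⟪w, ψ z⟫ = 0 := by
  obtain ⟨s, b, -⟩ := exists_hilbertBasis ℝ H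
  have hb1 : ∀ i, ‖b i‖ = 1 := b.orthonormal.1
  have hint : ∀ i, Integrable (fun z => ⟪b i, ψ z⟫ ^ 2) D := fun i =>
    integrable_of_abs_le (M := r ^ 2) ((hψ _).pow_const 2) fun z => by
      rw [abs_pow]
      refine pow_le_pow_left₀ (abs_nonneg _) ((abs_real_inner_le_norm _ _).trans ?_) 2
      rw [hb1, one_mul]
      exact hr z
  -- Bessel's inequality bounds every finite partial sum by `r ^ 2`, so only countably many basis
  -- directions have a nonzero second moment; these form `C`.
  have hsum : Summable fun i => ∫ z, ⟪b i, ψ z⟫ ^ 2 ∂D := by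
    refine summable_of_sum_le (c := r ^ 2) (fun i => integral_nonneg fun z => sq_nonneg _)
      fun u => ?_
    rw [← integral_finsetSum u fun i _ => hint i]
    calc ∫ z, ∑ i ∈ u, ⟪b i, ψ z⟫ ^ 2 ∂D ≤ ∫ z, r ^ 2 ∂D := by
          refine integral_mono (integrable_finsetSum u fun i _ => hint i) (integrable_const _)
            fun z => ?_
          have := b.orthonormal.sum_inner_products_le (ψ z) (s := u)
          simp only [Real.norm_eq_abs, sq_abs] at this
          exact this.trans (pow_le_pow_left₀ (norm_nonneg _) (hr z) 2)
      _ = r ^ 2 := by simp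
  refine ⟨b '' Function.support fun i => ∫ z, ⟪b i, ψ z⟫ ^ 2 ∂D,
    hsum.countable_support.image b, fun w hw => ?_⟩
  -- Only countably many coordinates of `w` are nonzero, so the exceptional null sets can be united.
  -- The resulting null set depends on `w`.
  have hwc : (Function.support fun i => ⟪w, b i⟫).Countable := by
    refine (b.orthonormal.inner_products_summable w).countable_support.mono fun i hi => ?_
    simpa [real_inner_comm] using hi
  have hae : ∀ᵐ z ∂D, ∀ i ∈ Function.support fun i => ⟪w, b i⟫, ⟪b i, ψ z⟫ = 0 := by
    rw [ae_ball_iff hwc]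
    intro i hi
    have h0 : ∫ z, ⟪b i, ψ z⟫ ^ 2 ∂D = 0 := by
      by_contra h
      exact hi (hw _ ⟨i, h, rfl⟩)
    rw [integral_eq_zero_iff_of_nonneg (fun z => sq_nonneg _) (hint i)] at h0
    filter_upwards [h0] with z hz
    simpa using hz
  filter_upwards [hae] with z hz
  rw [← b.tsum_inner_mul_inner w (ψ z)]
  have : ∀ i, ⟪w, b i⟫ * ⟪b i, ψ z⟫ = 0 := fun i => by
    by_cases h : ⟪w, b i⟫ = 0
    · rw [h, zero_mul]
    · rw [hz i h, mul_zero]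
  simp [this]

end FeatureMap

/-- The radial retraction onto the closed ball of radius `Λ`. -/
noncomputable def clip {H : Type*} [NormedAddCommGroup H] [NormedSpace ℝ H] (Λ : ℝ) (u : H) : H :=
  (Λ / max Λ ‖u‖) • u

section Clip

variable {H : Type*} [NormedAddCommGroup H] [NormedSpace ℝ H] {Λ : ℝ}

lemma norm_clip_le (hΛ : 0 ≤ Λ) (u : H) : ‖clip Λ u‖ ≤ Λ := by
  rcases hΛ.eq_or_lt with rfl | h
  · simp [clip]
  have hm : 0 < max Λ ‖u‖ := lt_max_of_lt_left h
  rw [clip, norm_smul, Real.norm_of_nonneg (by positivity), div_mul_eq_mul_div, div_le_iff₀ hm]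
  exact mul_le_mul_of_nonneg_left (le_max_right _ _) hΛ

lemma clip_eq_self (hΛ : 0 ≤ Λ) {u : H} (hu : ‖u‖ ≤ Λ) : clip Λ u = u := by
  rcases hΛ.eq_or_lt with rfl | h
  · rw [norm_le_zero_iff.1 hu, clip, smul_zero]
  · rw [clip, max_eq_left hu, div_self h.ne', one_smul]

lemma continuous_clip (hΛ : 0 ≤ Λ) : Continuous (clip Λ : H → H) := by
  rcases hΛ.eq_or_lt with rfl | h
  · have : (clip 0 : H → H) = fun _ => 0 := funext fun u => by simp [clip]
    rw [this]
    exact continuous_const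
  · refine Continuous.smul (continuous_const.div (continuous_const.max continuous_norm)
      fun u => (lt_max_of_lt_left h).ne') continuous_id

end Clip

lemma LipschitzWith.abs_le {l : ℝ → ℝ} {ρ : ℝ≥0} (hl : LipschitzWith ρ l) {u M : ℝ}
    (hu : |u| ≤ M) : |l u| ≤ |l 0| + ρ * M := by
  have h1 := hl.dist_le_mul u 0
  rw [Real.dist_eq, Real.dist_eq, sub_zero] at h1
  have h2 := abs_sub_abs_le_abs_sub (l u) (l 0)
  have h3 := h1.trans (mul_le_mul_of_nonneg_left hu ρ.2)
  linarith

lemma abs_inner_le_of_mem_closedBall {Z H : Type*} [NormedAddCommGroup H]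
    [InnerProductSpace ℝ H] {ψ : Z → H} {r Λ : ℝ} (hΛ : 0 ≤ Λ) (hr : ∀ z, ‖ψ z‖ ≤ r)
    (w : Metric.closedBall (0 : H) Λ) (z : Z) : |⟪(w : H), ψ z⟫| ≤ Λ * r :=
  (abs_real_inner_le_norm _ _).trans
    (mul_le_mul (mem_closedBall_zero_iff.1 w.2) (hr z) (norm_nonneg _) hΛ)

section LossFunctional

variable {Z H ι : Type*} [MeasurableSpace Z] [NormedAddCommGroup H] [InnerProductSpace ℝ H]
  [Fintype ι] {ψ : Z → H} {l : ℝ → ℝ} {ρ : ℝ≥0} {r Λ : ℝ}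

/-- A linear combination of the true loss of `w` and of its losses at the points of `S`. -/
noncomputable def lossFunctional (D : Measure Z) (ψ : Z → H) (l : ℝ → ℝ) (α : ℝ) (β : ι → ℝ)
    (S : ι → Z) (w : H) : ℝ :=
  α * ∫ z, l ⟪w, ψ z⟫ ∂D + ∑ i, β i * l ⟪w, ψ (S i)⟫

variable (D : Measure Z) [IsProbabilityMeasure D]

lemma integrable_comp_inner (hl : LipschitzWith ρ l) (hψ : ∀ w, Measurable fun z => ⟪w, ψ z⟫)
    (hr : ∀ z, ‖ψ z‖ ≤ r) (w : H) : Integrable (fun z => l ⟪w, ψ z⟫) D :=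
  integrable_of_abs_le (hl.continuous.measurable.comp (hψ w)) fun z =>
    LipschitzWith.abs_le hl ((abs_real_inner_le_norm _ _).trans
      (mul_le_mul_of_nonneg_left (hr z) (norm_nonneg w)))

lemma continuous_lossFunctional (hl : LipschitzWith ρ l)
    (hψ : ∀ w, Measurable fun z => ⟪w, ψ z⟫) (hr : ∀ z, ‖ψ z‖ ≤ r) (α : ℝ) (β : ι → ℝ)
    (S : ι → Z) : Continuous (lossFunctional D ψ l α β S) := by
  have hz : ∀ z, Continuous fun w : H => l ⟪w, ψ z⟫ := fun z =>
    hl.continuous.comp (continuous_id.inner continuous_const)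
  have hI : Continuous fun w : H => ∫ z, l ⟪w, ψ z⟫ ∂D := by
    refine (LipschitzWith.of_dist_le_mul (K := ρ * r.toNNReal) fun w w' => ?_).continuous
    rw [Real.dist_eq, ← integral_sub (integrable_comp_inner D hl hψ hr w)
      (integrable_comp_inner D hl hψ hr w')]
    have hb : ∀ z, ‖l ⟪w, ψ z⟫ - l ⟪w', ψ z⟫‖ ≤ ρ * r.toNNReal * dist w w' := fun z => by
      rw [mul_assoc]
      refine (hl.dist_le_mul _ _).trans (mul_le_mul_of_nonneg_left ?_ ρ.2)
      rw [Real.dist_eq, ← inner_sub_left, dist_eq_norm, mul_comm]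
      exact (abs_real_inner_le_norm _ _).trans (mul_le_mul_of_nonneg_left
        ((hr z).trans (Real.le_coe_toNNReal r)) (norm_nonneg _))
    simpa using norm_integral_le_of_norm_le_const (ae_of_all D hb)
  exact (continuous_const.mul hI).add
    (continuous_finsetSum _ fun i _ => continuous_const.mul (hz (S i)))

lemma abs_lossFunctional_le (hΛ : 0 ≤ Λ) (hr : ∀ z, ‖ψ z‖ ≤ r) {B : ℝ}
    (hB : ∀ u, |u| ≤ Λ * r → |l u| ≤ B) (α : ℝ) (β : ι → ℝ) (S : ι → Z)
    (w : Metric.closedBall (0 : H) Λ) :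
    |lossFunctional D ψ l α β S w| ≤ |α| * B + ∑ i, |β i| * B := by
  have h : ∀ z, |l ⟪(w : H), ψ z⟫| ≤ B := fun z => hB _ (abs_inner_le_of_mem_closedBall hΛ hr w z)
  refine (abs_add_le _ _).trans (add_le_add ?_ ?_)
  · rw [abs_mul]
    refine mul_le_mul_of_nonneg_left ?_ (abs_nonneg _)
    simpa using norm_integral_le_of_norm_le_const (f := fun z => l ⟪(w : H), ψ z⟫) (ae_of_all D h)
  · refine (Finset.abs_sum_le_sum_abs _ _).trans (Finset.sum_le_sum fun i _ => ?_)
    rw [abs_mul]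
    exact mul_le_mul_of_nonneg_left (h _) (abs_nonneg _)

variable [CompleteSpace H]

/-- The supremum of the loss functional over a ball can be taken over a countable family
of weights that depend on the sample. -/
theorem measurable_iSup_lossFunctional (hl : LipschitzWith ρ l)
    (hψ : Measurable fun p : Z × Z => ⟪ψ p.1, ψ p.2⟫) (hr : ∀ z, ‖ψ z‖ ≤ r) (hΛ : 0 ≤ Λ)
    (α : ℝ) (β : ι → ℝ) :
    Measurable fun S : ι → Z =>
      ⨆ w : Metric.closedBall (0 : H) Λ, lossFunctional D ψ l α β S w := by
  have hψw := measurable_inner_featureMap hψ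
  obtain ⟨C, hC, hCz⟩ := exists_countable_forall_ae_inner_eq_zero D hψw hr
  obtain ⟨T, hT, hCT⟩ := hC.isSeparable.span (R := ℝ)
  have : Countable T := hT
  have hTne : Nonempty T := by
    have := closure_nonempty_iff.1 ⟨0, hCT (Submodule.zero_mem _)⟩
    exact this.to_subtype
  -- The countable family of candidates: a point of a countable set dense around the span of `C`,
  -- plus a rational combination of the sample features. A candidate may leave the ball, hence the
  -- use of `clip`.
  let u : T × (ι → ℚ) → (ι → Z) → H := fun p S => p.1 + ∑ i, (p.2 i : ℝ) • ψ (S i)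
  have hne : Nonempty (Metric.closedBall (0 : H) Λ) := ⟨⟨0, Metric.mem_closedBall_self hΛ⟩⟩
  have hbdd : ∀ S, BddAbove (Set.range fun w : Metric.closedBall (0 : H) Λ =>
      lossFunctional D ψ l α β S w) := fun S =>
    bddAbove_range_of_abs_le (abs_lossFunctional_le D hΛ hr
      (fun v hv => LipschitzWith.abs_le hl hv) α β S)
  have hcont := continuous_lossFunctional D hl hψw hr α β
  have hle : ∀ S v, lossFunctional D ψ l α β S (clip Λ v) ≤
      ⨆ w : Metric.closedBall (0 : H) Λ, lossFunctional D ψ l α β S w := fun S v =>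
    le_ciSup (hbdd S) ⟨clip Λ v, mem_closedBall_zero_iff.2 (norm_clip_le hΛ v)⟩
  have hsup : ∀ S, (⨆ w : Metric.closedBall (0 : H) Λ, lossFunctional D ψ l α β S w) =
      ⨆ p, lossFunctional D ψ l α β S (clip Λ (u p S)) := fun S => by
    refine le_antisymm (ciSup_le fun w => ?_) (ciSup_le fun p => hle S _)
    -- Projecting `w` onto `V` keeps the integral, since `V` contains `C`, and the sample terms,
    -- since it contains the sample features. The candidates are dense around `V`, and continuity
    -- finishes the comparison.
    set V : Submodule ℝ H :=
      (Submodule.span ℝ C ⊔ Submodule.span ℝ (Set.range fun i => ψ (S i))).topologicalClosure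
    have hVC : IsClosed (V : Set H) := Submodule.isClosed_topologicalClosure _
    have : CompleteSpace V := hVC.completeSpace_coe
    set w' := V.starProjection (w : H)
    have horth : ∀ x ∈ Submodule.span ℝ C ⊔ Submodule.span ℝ (Set.range fun i => ψ (S i)),
        ⟪(w : H) - w', x⟫ = 0 := fun x hx =>
      (Submodule.mem_orthogonal' V _).1 (V.sub_starProjection_mem_orthogonal (w : H)) x
        (Submodule.le_topologicalClosure _ hx)
    have hww' : lossFunctional D ψ l α β S w = lossFunctional D ψ l α β S w' := by
      have h1 : ∀ᵐ z ∂D, ⟪(w : H) - w', ψ z⟫ = 0 := hCz _ fun e he =>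
        horth e (Submodule.mem_sup_left (Submodule.subset_span he))
      have h2 : ∀ i, ⟪(w : H) - w', ψ (S i)⟫ = 0 := fun i =>
        horth _ (Submodule.mem_sup_right (Submodule.subset_span ⟨i, rfl⟩))
      simp only [inner_sub_left, sub_eq_zero] at h1 h2
      simp only [lossFunctional, h2]
      congr 2
      exact integral_congr_ae (h1.mono fun z hz => by simp only [hz])
    have hw' : ‖w'‖ ≤ Λ :=
      (V.norm_starProjection_apply_le _).trans (mem_closedBall_zero_iff.1 w.2)
    have hbdd' : BddAbove (Set.range fun p => lossFunctional D ψ l α β S (clip Λ (u p S))) :=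
      ⟨_, by rintro _ ⟨p, rfl⟩; exact hle S _⟩
    have hclosed : IsClosed {x | lossFunctional D ψ l α β S (clip Λ x) ≤
        ⨆ p, lossFunctional D ψ l α β S (clip Λ (u p S))} :=
      isClosed_le ((hcont S).comp (continuous_clip hΛ)) continuous_const
    have hsub : (V : Set H) ⊆ closure (Set.range fun p => u p S) := by
      refine closure_minimal (fun x hx => ?_) isClosed_closure
      obtain ⟨y, hy, v, hv, rfl⟩ := Submodule.mem_sup.1 hx
      obtain ⟨a, rfl⟩ := (Submodule.mem_span_range_iff_exists_fun ℝ).1 hv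
      have hmap : Continuous fun p : H × (ι → ℝ) => p.1 + ∑ i, p.2 i • ψ (S i) := by fun_prop
      have ha : a ∈ closure (Set.range (Pi.map fun (_ : ι) (q : ℚ) => (q : ℝ))) :=
        DenseRange.piMap (fun _ => Rat.denseRange_cast) a
      have hya : (y, a) ∈ closure (T ×ˢ Set.range (Pi.map fun (_ : ι) (q : ℚ) => (q : ℝ))) := by
        rw [closure_prod_eq]
        exact ⟨hCT hy, ha⟩
      refine map_mem_closure (f := fun p : H × (ι → ℝ) => p.1 + ∑ i, p.2 i • ψ (S i)) hmap hya ?_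
      rintro ⟨t, _⟩ ⟨ht, q, rfl⟩
      exact ⟨(⟨t, ht⟩, q), rfl⟩
    have := closure_minimal (t := {x | lossFunctional D ψ l α β S (clip Λ x) ≤
        ⨆ p, lossFunctional D ψ l α β S (clip Λ (u p S))})
      (by rintro _ ⟨p, rfl⟩; exact le_ciSup hbdd' p) hclosed
      (hsub (V.starProjection_apply_mem (w : H)))
    rwa [Set.mem_ofPred_eq, clip_eq_self hΛ hw', ← hww'] at this
  simp_rw [hsup]
  refine Measurable.iSup fun p => ?_
  have hu : Measurable fun q : (ι → Z) × Z => ⟪u p q.1, ψ q.2⟫ := by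
    simp only [u, inner_add_left, sum_inner, real_inner_smul_left]
    refine ((hψw _).comp measurable_snd).add (Finset.measurable_sum _ fun i _ => ?_)
    exact (hψ.comp (g := fun p : Z × Z => ⟪ψ p.1, ψ p.2⟫)
      (f := fun q : (ι → Z) × Z => (q.1 i, q.2))
      (by fun_prop)).const_mul _
  have hui : ∀ i, Measurable fun S : ι → Z => ⟪u p S, ψ (S i)⟫ := fun i =>
    hu.comp (measurable_id.prodMk (measurable_pi_apply i))
  have huu : Measurable fun S : ι → Z => ‖u p S‖ := by
    -- `u p` need not be measurable as an `H`-valued map; its norm is measurable because it is a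
    -- function of measurable inner products.
    have : ∀ S, ‖u p S‖ =
        √(⟪u p S, (p.1 : H)⟫ + ∑ i, (p.2 i : ℝ) * ⟪u p S, ψ (S i)⟫) := fun S => by
      rw [norm_eq_sqrt_real_inner]
      nth_rw 2 [show u p S = p.1 + ∑ i, (p.2 i : ℝ) • ψ (S i) from rfl]
      simp only [inner_add_right, inner_sum, real_inner_smul_right]
    simp_rw [this]
    refine Measurable.sqrt (Measurable.add ?_
      (Finset.measurable_sum _ fun i _ => (hui i).const_mul _))
    simp only [u, inner_add_left, sum_inner, real_inner_smul_left]
    refine measurable_const.add (Finset.measurable_sum _ fun i _ => Measurable.const_mul ?_ _)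
    simp_rw [real_inner_comm]
    exact (hψw _).comp (measurable_pi_apply i)
  have hθ : Measurable fun S : ι → Z => Λ / max Λ ‖u p S‖ :=
    measurable_const.div (measurable_const.max huu)
  have hlm := hl.continuous.measurable
  simp only [lossFunctional, clip, real_inner_smul_left]
  refine Measurable.add (Measurable.const_mul ?_ _) (Finset.measurable_sum _ fun i _ =>
    (hlm.comp (hθ.mul (hui i))).const_mul _)
  exact (hlm.comp ((hθ.comp measurable_fst).mul
    hu)).stronglyMeasurable.integral_prod_right'.measurable

end LossFunctional

/-! ### Symmetrization with a ghost sample -/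

/-- The permutation of `Fin n ⊕ Fin n` that swaps the two copies of `i` when `ε i` is false. -/
def signSwap {n : ℕ} (ε : Fin n → Bool) : Equiv.Perm (Fin n ⊕ Fin n) :=
  Function.Involutive.toPerm
    (Sum.elim (fun i => if ε i then .inl i else .inr i) (fun i => if ε i then .inr i else .inl i))
    (by rintro (i | i) <;> cases h : ε i <;> simp [h])

lemma signSwap_inl {n : ℕ} (ε : Fin n → Bool) (i : Fin n) :
    signSwap ε (.inl i) = if ε i then .inl i else .inr i := rfl

lemma signSwap_inr {n : ℕ} (ε : Fin n → Bool) (i : Fin n) :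
    signSwap ε (.inr i) = if ε i then .inr i else .inl i := rfl

lemma measurePreserving_comp_perm {ι Z : Type*} [Fintype ι] [MeasurableSpace Z] (D : Measure Z)
    [IsProbabilityMeasure D] (σ : Equiv.Perm ι) :
    MeasurePreserving (fun T : ι → Z => T ∘ σ) (Measure.pi fun _ => D) (Measure.pi fun _ => D) := by
  convert measurePreserving_piCongrLeft (fun _ : ι => D) σ.symm using 1
  funext T i
  obtain ⟨j, rfl⟩ := σ.symm.surjective i
  rw [MeasurableEquiv.piCongrLeft_apply_apply]
  simp

section UniformDeviation

variable {Z H : Type*} [MeasurableSpace Z] [NormedAddCommGroup H] [InnerProductSpace ℝ H]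
  {ψ : Z → H} {l : ℝ → ℝ} {ρ : ℝ≥0} {r Λ B : ℝ} {n : ℕ}

/-- The largest excess, over weights in a ball, of the true loss over the empirical loss. -/
noncomputable def uniformDeviation (D : Measure Z) (ψ : Z → H) (l : ℝ → ℝ) (Λ : ℝ)
    (S : Fin n → Z) : ℝ :=
  ⨆ w : Metric.closedBall (0 : H) Λ, lossFunctional D ψ l 1 (fun _ => -(1 / n : ℝ)) S w

/-- The largest excess, over weights in a ball, of the empirical loss on the second half of a
double sample over the empirical loss on the first half. -/
noncomputable def ghostDeviation (D : Measure Z) (ψ : Z → H) (l : ℝ → ℝ) (Λ : ℝ)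
    (T : Fin n ⊕ Fin n → Z) : ℝ :=
  ⨆ w : Metric.closedBall (0 : H) Λ,
    lossFunctional D ψ l 0 (Sum.elim (fun _ => -(1 / n : ℝ)) fun _ => 1 / n) T w

lemma abs_iSup_le {T : Type*} [Nonempty T] {f : T → ℝ} {M : ℝ} (hM : ∀ t, |f t| ≤ M) :
    |⨆ t, f t| ≤ M := by
  obtain ⟨t⟩ := ‹Nonempty T›
  refine abs_le.2 ⟨?_, ciSup_le fun t => (abs_le.1 (hM t)).2⟩
  exact (abs_le.1 (hM t)).1.trans (le_ciSup (bddAbove_range_of_abs_le hM) t)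

/-- Swapping the pair at `i` flips the sign of its difference of losses. Splitting the supremum
between the two half-samples leaves two Rademacher sums, one with all signs negated, which the sum
over `ε` does not see. -/
lemma sum_ghostDeviation_comp_signSwap_le (D : Measure Z) (hl : LipschitzWith ρ l)
    (hr0 : 0 ≤ r) (hr : ∀ z, ‖ψ z‖ ≤ r) (hΛ : 0 ≤ Λ) (T : Fin n ⊕ Fin n → Z) :
    ∑ ε : Fin n → Bool, ghostDeviation D ψ l Λ (T ∘ signSwap ε) ≤
      2 ^ n * (2 * (ρ * Λ * r * √n) / n) := by
  have hne : Nonempty (Metric.closedBall (0 : H) Λ) := ⟨⟨0, Metric.mem_closedBall_self hΛ⟩⟩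
  have hb : ∀ (S : Fin n → Z) (ε : Fin n → Bool) (w : Metric.closedBall (0 : H) Λ),
      |∑ i, sign (ε i) * l ⟪(w : H), ψ (S i)⟫| ≤ ∑ _i : Fin n, (|l 0| + ρ * (Λ * r)) :=
    fun S ε w => by
      refine (Finset.abs_sum_le_sum_abs _ _).trans (Finset.sum_le_sum fun i _ => ?_)
      rw [abs_mul, abs_sign, one_mul]
      exact LipschitzWith.abs_le hl (abs_inner_le_of_mem_closedBall hΛ hr w _)
  let R : (Fin n → Z) → (Fin n → Bool) → ℝ := fun S ε =>
    ⨆ w : Metric.closedBall (0 : H) Λ, ∑ i, sign (ε i) * l ⟪(w : H), ψ (S i)⟫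
  have hR : ∀ S, ∑ ε, R S ε ≤ 2 ^ n * (ρ * Λ * r * √n) := fun S =>
    sum_iSup_sign_lipschitz_le (fun i => ψ (S i)) hΛ hr0 (fun i => hr _) hl
  have key : ∀ ε : Fin n → Bool, ghostDeviation D ψ l Λ (T ∘ signSwap ε) ≤
      (1 / n : ℝ) * (R (fun i => T (.inr i)) ε + R (fun i => T (.inl i)) fun i => !ε i) :=
    fun ε => by
      refine ciSup_le fun w => ?_
      have e : lossFunctional D ψ l 0 (Sum.elim (fun _ => -(1 / n : ℝ)) fun _ => 1 / n)
          (T ∘ signSwap ε) (w : H) =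
          (1 / n : ℝ) * (∑ i, sign (ε i) * l ⟪(w : H), ψ (T (.inr i))⟫ +
            ∑ i, sign (!ε i) * l ⟪(w : H), ψ (T (.inl i))⟫) := by
        rw [lossFunctional, zero_mul, zero_add, Fintype.sum_sum_type, ← Finset.sum_add_distrib,
          ← Finset.sum_add_distrib, Finset.mul_sum]
        refine Finset.sum_congr rfl fun i _ => ?_
        cases h : ε i <;> simp [signSwap_inl, signSwap_inr, h] <;> ring
      rw [e]
      refine mul_le_mul_of_nonneg_left (add_le_add ?_ ?_) (by positivity)
      · exact le_ciSup (bddAbove_range_of_abs_le (hb _ ε)) w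
      · exact le_ciSup (bddAbove_range_of_abs_le (hb _ fun i => !ε i)) w
  refine (Finset.sum_le_sum fun ε _ => key ε).trans ?_
  rw [← Finset.mul_sum, Finset.sum_add_distrib, sum_sign_not (R fun i => T (.inl i))]
  calc (1 / n : ℝ) * (∑ ε, R (fun i => T (.inr i)) ε + ∑ ε, R (fun i => T (.inl i)) ε)
      ≤ (1 / n : ℝ) * (2 ^ n * (ρ * Λ * r * √n) + 2 ^ n * (ρ * Λ * r * √n)) :=
        mul_le_mul_of_nonneg_left (add_le_add (hR _) (hR _)) (by positivity)
    _ = _ := by ring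

variable (D : Measure Z) [IsProbabilityMeasure D]

lemma integral_sub_average_le_uniformDeviation (hΛ : 0 ≤ Λ) (hr : ∀ z, ‖ψ z‖ ≤ r)
    (hB : ∀ u, |u| ≤ Λ * r → |l u| ≤ B) (S : Fin n → Z) {w : H} (hw : ‖w‖ ≤ Λ) :
    ∫ z, l ⟪w, ψ z⟫ ∂D - 1 / n * ∑ i, l ⟪w, ψ (S i)⟫ ≤ uniformDeviation D ψ l Λ S := by
  have := le_ciSup (bddAbove_range_of_abs_le
    (abs_lossFunctional_le D hΛ hr hB 1 (fun _ => -(1 / n : ℝ)) S))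
    (⟨w, mem_closedBall_zero_iff.2 hw⟩ : Metric.closedBall (0 : H) Λ)
  refine le_trans (le_of_eq ?_) this
  simp only [lossFunctional, one_mul, neg_mul, Finset.sum_neg_distrib, Finset.mul_sum]
  ring

/-- Nonnegativity of `l` puts the attained losses in `[0, B]`, giving `B / n` in place of `2 * B /
n`. The opposite inequality comes from undoing the update. -/
lemma uniformDeviation_update_le (hΛ : 0 ≤ Λ) (hr : ∀ z, ‖ψ z‖ ≤ r)
    (hl0 : ∀ u, 0 ≤ l u) (hB : ∀ u, |u| ≤ Λ * r → |l u| ≤ B) (S : Fin n → Z) (i : Fin n) (z : Z) :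
    |uniformDeviation D ψ l Λ (Function.update S i z) - uniformDeviation D ψ l Λ S| ≤ B / n := by
  have hne : Nonempty (Metric.closedBall (0 : H) Λ) := ⟨⟨0, Metric.mem_closedBall_self hΛ⟩⟩
  have key : ∀ (S : Fin n → Z) z, uniformDeviation D ψ l Λ (Function.update S i z) ≤
      uniformDeviation D ψ l Λ S + B / n := fun S z => by
    refine ciSup_le fun w => ?_
    have h1 : lossFunctional D ψ l 1 (fun _ => -(1 / n : ℝ)) S w ≤ uniformDeviation D ψ l Λ S :=
      le_ciSup (bddAbove_range_of_abs_le
        (abs_lossFunctional_le D hΛ hr hB 1 (fun _ => -(1 / n : ℝ)) S)) w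
    have h2 : lossFunctional D ψ l 1 (fun _ => -(1 / n : ℝ)) (Function.update S i z) w =
        lossFunctional D ψ l 1 (fun _ => -(1 / n : ℝ)) S w
          + 1 / n * (l ⟪(w : H), ψ (S i)⟫ - l ⟪(w : H), ψ z⟫) := by
      simp only [lossFunctional]
      rw [← Finset.add_sum_erase _ _ (Finset.mem_univ i),
        ← Finset.add_sum_erase (a := i) _ (fun j => -(1 / n : ℝ) * l ⟪(w : H), ψ (S j)⟫)
          (Finset.mem_univ i), Function.update_self]
      rw [Finset.sum_congr rfl fun j hj => by rw [Function.update_of_ne (Finset.ne_of_mem_erase hj)]]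
      ring
    have h3 : l ⟪(w : H), ψ (S i)⟫ - l ⟪(w : H), ψ z⟫ ≤ B := by
      have := (le_abs_self _).trans (hB _ (abs_inner_le_of_mem_closedBall hΛ hr w (S i)))
      linarith [hl0 ⟪(w : H), ψ z⟫]
    have h4 := mul_le_mul_of_nonneg_left h3 (show (0 : ℝ) ≤ 1 / n by positivity)
    rw [h2]
    calc _ ≤ uniformDeviation D ψ l Λ S + 1 / n * B := add_le_add h1 h4
      _ = _ := by ring
  rw [abs_le]
  have := key (Function.update S i z) (S i)
  rw [Function.update_idem, Function.update_eq_self] at this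
  constructor <;> linarith [key S z]

lemma abs_uniformDeviation_le (hΛ : 0 ≤ Λ) (hr : ∀ z, ‖ψ z‖ ≤ r)
    (hB : ∀ u, |u| ≤ Λ * r → |l u| ≤ B) (S : Fin n → Z) :
    |uniformDeviation D ψ l Λ S| ≤ |1| * B + ∑ _i : Fin n, |-(1 / n : ℝ)| * B := by
  have hne : Nonempty (Metric.closedBall (0 : H) Λ) := ⟨⟨0, Metric.mem_closedBall_self hΛ⟩⟩
  exact abs_iSup_le (abs_lossFunctional_le D hΛ hr hB 1 _ S)

variable [CompleteSpace H]

lemma measurable_uniformDeviation (hl : LipschitzWith ρ l)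
    (hψ : Measurable fun p : Z × Z => ⟪ψ p.1, ψ p.2⟫) (hr : ∀ z, ‖ψ z‖ ≤ r) (hΛ : 0 ≤ Λ) :
    Measurable fun S : Fin n → Z => uniformDeviation D ψ l Λ S :=
  measurable_iSup_lossFunctional D hl hψ hr hΛ _ _

/-- Symmetrization: the expected uniform deviation is at most twice the Rademacher bound. -/
theorem integral_uniformDeviation_le (hn : 0 < n) (hl : LipschitzWith ρ l)
    (hψ : Measurable fun p : Z × Z => ⟪ψ p.1, ψ p.2⟫) (hr0 : 0 ≤ r) (hr : ∀ z, ‖ψ z‖ ≤ r)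
    (hΛ : 0 ≤ Λ) :
    ∫ S : Fin n → Z, uniformDeviation D ψ l Λ S ∂(Measure.pi fun _ => D) ≤
      2 * (ρ * Λ * r * √n) / n := by
  have hne : Nonempty (Metric.closedBall (0 : H) Λ) := ⟨⟨0, Metric.mem_closedBall_self hΛ⟩⟩
  have hn' : (n : ℝ) ≠ 0 := by positivity
  have hψw := measurable_inner_featureMap hψ
  have hB : ∀ u, |u| ≤ Λ * r → |l u| ≤ |l 0| + ρ * (Λ * r) := fun u hu =>
    LipschitzWith.abs_le hl hu
  set β : Fin n ⊕ Fin n → ℝ := Sum.elim (fun _ => -(1 / n : ℝ)) fun _ => 1 / n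
  have hQm : Measurable fun T : Fin n ⊕ Fin n → Z => ghostDeviation D ψ l Λ T :=
    measurable_iSup_lossFunctional D hl hψ hr hΛ _ _
  have hQb : ∀ T : Fin n ⊕ Fin n → Z, |ghostDeviation D ψ l Λ T| ≤ _ := fun T =>
    abs_iSup_le (abs_lossFunctional_le D hΛ hr hB 0 _ T)
  have mp := measurePreserving_sumPiEquivProdPi_symm (fun _ : Fin n ⊕ Fin n => D)
  set e := (MeasurableEquiv.sumPiEquivProdPi fun _ : Fin n ⊕ Fin n => Z).symm
  have hQe : Integrable (fun p => ghostDeviation D ψ l Λ (e p))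
      ((Measure.pi fun _ : Fin n => D).prod (Measure.pi fun _ : Fin n => D)) :=
    integrable_of_abs_le (hQm.comp e.measurable) fun p => hQb _
  -- The true loss is the mean loss on an independent ghost sample, and a supremum of integrals is
  -- at most the integral of the supremum.
  have hghost : ∀ S : Fin n → Z, uniformDeviation D ψ l Λ S ≤
      ∫ S', ghostDeviation D ψ l Λ (e (S, S')) ∂(Measure.pi fun _ : Fin n => D) := fun S => by
    refine ciSup_le fun w => ?_
    have hli : ∀ i : Fin n, Integrable (fun S' : Fin n → Z => 1 / n * l ⟪(w : H), ψ (S' i)⟫)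
        (Measure.pi fun _ : Fin n => D) := fun i =>
      (((measurePreserving_eval (fun _ : Fin n => D) i).integrable_comp
        (integrable_comp_inner D hl hψw hr w).aestronglyMeasurable).2
          (integrable_comp_inner D hl hψw hr w)).const_mul _
    have hsum : ∀ S' : Fin n → Z, lossFunctional D ψ l 0 β (e (S, S')) w =
        (∑ i, -(1 / n : ℝ) * l ⟪(w : H), ψ (S i)⟫) + ∑ i, 1 / n * l ⟪(w : H), ψ (S' i)⟫ :=
      fun S' => by
        rw [lossFunctional, zero_mul, zero_add, Fintype.sum_sum_type]
        rfl
    have heq : lossFunctional D ψ l 1 (fun _ => -(1 / n : ℝ)) S (w : H) =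
        ∫ S', lossFunctional D ψ l 0 β (e (S, S')) w ∂(Measure.pi fun _ : Fin n => D) := by
      simp_rw [hsum]
      rw [integral_add (integrable_const _) (integrable_finsetSum _ fun i _ => hli i),
        integral_finsetSum _ fun i _ => hli i]
      have : ∀ i : Fin n, ∫ S' : Fin n → Z, 1 / n * l ⟪(w : H), ψ (S' i)⟫
          ∂(Measure.pi fun _ : Fin n => D) = 1 / n * ∫ z, l ⟪(w : H), ψ z⟫ ∂D := fun i => by
        rw [integral_const_mul]
        congr 1
        exact integral_comp_eval (μ := fun _ : Fin n => D) (i := i)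
          (f := fun z => l ⟪(w : H), ψ z⟫)
          (integrable_comp_inner D hl hψw hr w).aestronglyMeasurable
      simp only [this, integral_const, probReal_univ, one_smul, Finset.sum_const, Finset.card_univ,
        Fintype.card_fin, nsmul_eq_mul, lossFunctional]
      field_simp
      ring
    rw [heq]
    refine integral_mono ?_ (integrable_of_abs_le
      (hQm.comp (e.measurable.comp measurable_prodMk_left)) fun S' => hQb _) fun S' =>
        le_ciSup (bddAbove_range_of_abs_le (abs_lossFunctional_le D hΛ hr hB 0 β _)) w
    simp_rw [hsum]
    exact (integrable_const _).add (integrable_finsetSum _ fun i _ => hli i)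
  have h1 : ∫ S : Fin n → Z, uniformDeviation D ψ l Λ S ∂(Measure.pi fun _ => D) ≤
      ∫ T, ghostDeviation D ψ l Λ T ∂(Measure.pi fun _ : Fin n ⊕ Fin n => D) := by
    rw [← mp.integral_comp', integral_prod _ hQe]
    exact integral_mono (integrable_of_abs_le (measurable_uniformDeviation D hl hψ hr hΛ)
      (abs_uniformDeviation_le D hΛ hr hB)) hQe.integral_prod_left hghost
  -- Permuting i.i.d. coordinates preserves the product measure, so the integral may be averaged
  -- over all swaps and the pointwise Rademacher bound applied.
  have h2 : ∀ ε : Fin n → Bool,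
      ∫ T, ghostDeviation D ψ l Λ (T ∘ signSwap ε) ∂(Measure.pi fun _ : Fin n ⊕ Fin n => D) =
      ∫ T, ghostDeviation D ψ l Λ T ∂(Measure.pi fun _ : Fin n ⊕ Fin n => D) := fun ε => by
    have mpε := measurePreserving_comp_perm D (signSwap ε)
    nth_rw 2 [← mpε.map_eq]
    rw [integral_map mpε.measurable.aemeasurable hQm.aestronglyMeasurable]
  have h3 : (2 : ℝ) ^ n * ∫ T, ghostDeviation D ψ l Λ T
      ∂(Measure.pi fun _ : Fin n ⊕ Fin n => D) ≤ 2 ^ n * (2 * (ρ * Λ * r * √n) / n) := by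
    have hi : ∀ ε : Fin n → Bool, Integrable (fun T : Fin n ⊕ Fin n → Z =>
        ghostDeviation D ψ l Λ (T ∘ signSwap ε)) (Measure.pi fun _ => D) := fun ε =>
      integrable_of_abs_le (hQm.comp (measurePreserving_comp_perm D (signSwap ε)).measurable)
        fun T => hQb _
    calc (2 : ℝ) ^ n * ∫ T, ghostDeviation D ψ l Λ T ∂(Measure.pi fun _ : Fin n ⊕ Fin n => D)
        = ∑ ε : Fin n → Bool, ∫ T, ghostDeviation D ψ l Λ (T ∘ signSwap ε)
            ∂(Measure.pi fun _ : Fin n ⊕ Fin n => D) := by simp [h2]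
      _ = ∫ T, ∑ ε : Fin n → Bool, ghostDeviation D ψ l Λ (T ∘ signSwap ε)
            ∂(Measure.pi fun _ : Fin n ⊕ Fin n => D) :=
          (integral_finsetSum _ fun ε _ => hi ε).symm
      _ ≤ ∫ T, 2 ^ n * (2 * (ρ * Λ * r * √n) / n) ∂(Measure.pi fun _ : Fin n ⊕ Fin n => D) :=
          integral_mono (integrable_finsetSum _ fun ε _ => hi ε) (integrable_const _)
            fun T => sum_ghostDeviation_comp_signSwap_le D hl hr0 hr hΛ T
      _ = _ := by simp
  exact h1.trans (le_of_mul_le_mul_left h3 (by positivity))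

end UniformDeviation

/-! ### Signed features and comparison of risks -/

lemma Label.abs_coe (y : Label) : |(y : ℝ)| = 1 := by
  rcases y.2 with h | h <;> rw [h] <;> simp

/-- The feature map of the `j`-th label: the features of the input, signed by the label. -/
def signedFeature {X H : Type*} [NormedAddCommGroup H] [InnerProductSpace ℝ H] {c : ℕ}
    (φ : X → H) (j : Fin c) (z : X × (Fin c → Label)) : H :=
  (z.2 j : ℝ) • φ z.1

section SignedFeature

variable {X H : Type*} [NormedAddCommGroup H] [InnerProductSpace ℝ H] {c : ℕ} {φ : X → H}

lemma norm_signedFeature (j : Fin c) (z : X × (Fin c → Label)) :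
    ‖signedFeature φ j z‖ = ‖φ z.1‖ := by
  rw [signedFeature, norm_smul, Real.norm_eq_abs, Label.abs_coe, one_mul]

lemma inner_signedFeature (w : H) (j : Fin c) (z : X × (Fin c → Label)) :
    ⟪w, signedFeature φ j z⟫ = (z.2 j : ℝ) * ⟪w, φ z.1⟫ :=
  real_inner_smul_right _ _ _

lemma measurable_inner_signedFeature [MeasurableSpace X]
    (hφ : Measurable fun p : X × X => ⟪φ p.1, φ p.2⟫) (j : Fin c) :
    Measurable fun p : (X × (Fin c → Label)) × (X × (Fin c → Label)) =>
      ⟪signedFeature φ j p.1, signedFeature φ j p.2⟫ := by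
  simp only [signedFeature, real_inner_smul_left, real_inner_smul_right]
  have h1 : Measurable fun p : (X × (Fin c → Label)) × (X × (Fin c → Label)) =>
      ⟪φ p.1.1, φ p.2.1⟫ := hφ.comp (g := fun p : X × X => ⟪φ p.1, φ p.2⟫)
        (f := fun p : (X × (Fin c → Label)) × (X × (Fin c → Label)) => (p.1.1, p.2.1))
        (by fun_prop)
  have hy : Measurable fun z : X × (Fin c → Label) => (z.2 j : ℝ) :=
    measurable_subtype_coe.comp ((measurable_pi_apply j).comp measurable_snd)
  exact (hy.comp measurable_snd).mul ((hy.comp measurable_fst).mul h1)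

end SignedFeature

lemma hammingLoss01_nonneg {c : ℕ} (h y : Fin c → Label) : 0 ≤ hammingLoss01 h y :=
  mul_nonneg (by positivity) (Finset.sum_nonneg fun j _ => by split_ifs <;> simp)

lemma subsetLoss01_nonneg {c : ℕ} (h y : Fin c → Label) : 0 ≤ subsetLoss01 h y :=
  Real.iSup_nonneg fun j => by split_ifs <;> simp

lemma subsetLoss01_le_mul_hammingLoss01 {c : ℕ} (hc : 0 < c) (h y : Fin c → Label) :
    subsetLoss01 h y ≤ c * hammingLoss01 h y := by
  have hc' : (c : ℝ) ≠ 0 := by positivity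
  have : Nonempty (Fin c) := ⟨⟨0, hc⟩⟩
  rw [hammingLoss01, ← mul_assoc, mul_one_div_cancel hc', one_mul]
  refine ciSup_le fun j => ?_
  exact Finset.single_le_sum (f := fun j => if h j ≠ y j then (1 : ℝ) else 0)
    (fun j _ => by split_ifs <;> simp) (Finset.mem_univ j)

lemma measurable_sgn : Measurable sgn :=
  Measurable.ite measurableSet_Ioi measurable_const measurable_const

section Risk

variable {X : Type*} [MeasurableSpace X] {c : ℕ} (D : Measure (X × (Fin c → Label)))

lemma integrable_hammingLoss01_classifier [IsProbabilityMeasure D] {f : X → Fin c → ℝ}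
    (hf : ∀ j, Measurable fun x => f x j) :
    Integrable (fun z => hammingLoss01 (classifier f z.1) z.2) D := by
  refine Integrable.const_mul (integrable_finsetSum _ fun j _ => ?_) _
  refine integrable_of_abs_le (M := 1) (Measurable.ite ?_ measurable_const measurable_const)
    fun z => by split_ifs <;> simp
  refine (measurableSet_eq_fun ?_ ((measurable_pi_apply j).comp measurable_snd)).compl
  exact measurable_sgn.comp ((hf j).comp measurable_fst)

theorem subsetRisk01_le_mul_hammingRisk01 [IsProbabilityMeasure D] (hc : 0 < c) {f : X → Fin c → ℝ}
    (hf : ∀ j, Measurable fun x => f x j) :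
    subsetRisk01 D (classifier f) ≤ c * hammingRisk01 D (classifier f) := by
  rw [subsetRisk01, hammingRisk01, ← integral_const_mul]
  -- Only the larger side must be integrable, so measurability of the subset loss is not needed.
  exact integral_mono_of_nonneg (ae_of_all _ fun z => subsetLoss01_nonneg _ _)
    ((integrable_hammingLoss01_classifier D hf).const_mul _)
    (ae_of_all _ fun z => subsetLoss01_le_mul_hammingLoss01 hc _ _)

theorem hammingRisk01_le_average_integral {f : X → Fin c → ℝ} {l : ℝ → ℝ}
    (hl01 : ∀ (t : ℝ) (y : Label), (if sgn t ≠ y then (1 : ℝ) else 0) ≤ l ((y : ℝ) * t))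
    (hint : ∀ j, Integrable (fun z => l ((z.2 j : ℝ) * f z.1 j)) D) :
    hammingRisk01 D (classifier f) ≤ 1 / c * ∑ j, ∫ z, l ((z.2 j : ℝ) * f z.1 j) ∂D := by
  rw [← integral_finsetSum _ fun j _ => hint j, ← integral_const_mul]
  refine integral_mono_of_nonneg (ae_of_all _ fun z => hammingLoss01_nonneg _ _)
    ((integrable_finsetSum _ fun j _ => hint j).const_mul _) (ae_of_all _ fun z => ?_)
  exact mul_le_mul_of_nonneg_left (Finset.sum_le_sum fun j _ => hl01 _ _) (by positivity)

end Risk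

lemma empiricalHammingRisk_eq_average {X : Type*} {c n : ℕ} (l : ℝ → ℝ)
    (S : Fin n → X × (Fin c → Label)) (f : X → Fin c → ℝ) :
    empiricalHammingRisk l S f =
      1 / c * ∑ j, 1 / n * ∑ i, l (((S i).2 j : ℝ) * f (S i).1 j) := by
  simp only [empiricalHammingRisk, hammingLoss, Finset.mul_sum]
  rw [Finset.sum_comm]
  exact Finset.sum_congr rfl fun j _ => Finset.sum_congr rfl fun i _ => by ring

/-- A function of an i.i.d. sample with bounded differences rarely exceeds its mean. -/
theorem exists_measurableSet_le_integral_add {Z : Type*} [MeasurableSpace Z] (D : Measure Z)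
    [IsProbabilityMeasure D] {n : ℕ} (hn : 0 < n) {B M δ : ℝ} (hB : 0 < B) (hδ : 0 < δ)
    (hδ1 : δ < 1) {f : (Fin n → Z) → ℝ} (hf : Measurable f) (hM : ∀ S, |f S| ≤ M)
    (hd : ∀ S i z, |f (Function.update S i z) - f S| ≤ B / n) :
    ∃ E : Set (Fin n → Z), MeasurableSet E ∧
      ENNReal.ofReal (1 - δ) ≤ Measure.pi (fun _ : Fin n => D) E ∧
      ∀ S ∈ E, f S ≤ ∫ S', f S' ∂(Measure.pi fun _ => D)
        + B * √(Real.log (1 / δ) / (2 * n)) := by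
  have hn' : (0 : ℝ) < n := Nat.cast_pos.2 hn
  have hsub := hasSubgaussianMGF_pi_of_bounded_differences D (B / n) M n f hf hM hd
  set P : Measure (Fin n → Z) := Measure.pi fun _ => D
  set t := B * √(Real.log (1 / δ) / (2 * n)) with ht
  have hlog : 0 < Real.log (1 / δ) := Real.log_pos ((one_lt_div hδ).2 hδ1)
  have htail := hsub.measure_ge_le (show 0 ≤ t by positivity)
  -- The value of `t` makes the sub-Gaussian tail exactly `δ`: the variance proxy is `B ^ 2 / (4 *
  -- n)`.
  have hexp : -t ^ 2 / (2 * ((n * (‖B / n‖₊ / 2) ^ 2 : ℝ≥0) : ℝ)) = Real.log δ := by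
    push_cast
    rw [ht, mul_pow, Real.sq_sqrt (by positivity), Real.norm_of_nonneg (by positivity), one_div,
      Real.log_inv]
    field_simp
  rw [hexp, Real.exp_log hδ] at htail
  have hmeas : MeasurableSet {S | t ≤ f S - ∫ S', f S' ∂P} :=
    measurableSet_le measurable_const (hf.sub_const _)
  refine ⟨{S | t ≤ f S - ∫ S', f S' ∂P}ᶜ, hmeas.compl, ?_, fun S hS => ?_⟩
  · rw [← ofReal_measureReal]
    refine ENNReal.ofReal_le_ofReal ?_
    rw [probReal_compl_eq_one_sub hmeas]
    linarith
  · have : f S - ∫ S', f S' ∂P < t := not_le.1 hS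
    linarith

end MultiLabel

/-! ### Assembly of the bound -/

open MultiLabel in
theorem theorem3
    {d c n : ℕ} (hc : 0 < c) (hn : 0 < n)
    -- the input set, and the distribution on inputs and label vectors
    (X : Set (EuclideanSpace ℝ (Fin d)))
    (D : Measure (X × (Fin c → MultiLabel.Label))) [IsProbabilityMeasure D]
    -- the kernel, with a feature map into a Hilbert space, bounded by `r ^ 2` on the diagonal
    {H : Type*} [NormedAddCommGroup H] [InnerProductSpace ℝ H] [CompleteSpace H]
    (κ : X → X → ℝ) (φ : X → H) (hφ : MultiLabel.IsFeatureMap κ φ)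
    (hκ : Measurable (fun p : X × X => κ p.1 p.2))
    (r : ℝ) (hr : 0 < r) (hκr : ∀ x, κ x x ≤ r ^ 2)
    (Λ : ℝ)
    -- the base loss: Lipschitz, bounded by `B` at all attainable arguments, above the 0/1 loss
    (l : ℝ → ℝ) (ρ : ℝ≥0) (B : ℝ) (hl : LipschitzWith ρ l)
    (hlB : ∀ u : ℝ, |u| ≤ Λ * r → |l u| ≤ B)
    (hl01 : ∀ (t : ℝ) (y : MultiLabel.Label),
      (if MultiLabel.sgn t ≠ y then (1 : ℝ) else 0) ≤ l ((y : ℝ) * t))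
    (δ : ℝ) (hδ : 0 < δ) :
    ∃ E : Set (Fin n → X × (Fin c → MultiLabel.Label)),
      MeasurableSet E ∧
      ENNReal.ofReal (1 - δ) ≤ Measure.pi (fun _ : Fin n => D) E ∧
      ∀ S ∈ E, ∀ f ∈ MultiLabel.hypothesisSet c φ Λ,
        MultiLabel.subsetRisk01 D (MultiLabel.classifier f)
            ≤ c * MultiLabel.hammingRisk01 D (MultiLabel.classifier f) ∧
        c * MultiLabel.hammingRisk01 D (MultiLabel.classifier f)
            ≤ c * MultiLabel.empiricalHammingRisk l S f
              + 2 * √2 * ρ * c * √(Λ ^ 2 * r ^ 2 / n)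
              + 3 * B * c * √(Real.log (2 / δ) / (2 * n)) := by
  -- For `δ ≥ 1` the required probability is zero; for `Λ < 0` the hypothesis set is empty.
  rcases le_or_gt 1 δ with hδ1 | hδ1
  · exact ⟨∅, MeasurableSet.empty, by simp [ENNReal.ofReal_eq_zero.2 (sub_nonpos.2 hδ1)],
      fun S hS => hS.elim⟩
  rcases lt_or_ge Λ 0 with hΛ | hΛ
  · refine ⟨Set.univ, MeasurableSet.univ, ?_, ?_⟩
    · rw [measure_univ, ENNReal.ofReal_le_one]
      linarith
    · rintro S - f ⟨W, hW, -⟩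
      exact absurd ((Real.sqrt_nonneg _).trans hW) (not_le.2 hΛ)
  have hn' : (0 : ℝ) < n := Nat.cast_pos.2 hn
  have hc' : (0 : ℝ) < c := Nat.cast_pos.2 hc
  have hφm : Measurable fun p : X × X => ⟪φ p.1, φ p.2⟫ := by
    simpa only [hφ _ _] using hκ
  have hφr : ∀ x, ‖φ x‖ ≤ r := fun x => by
    have := hκr x
    rw [hφ, real_inner_self_eq_norm_sq] at this
    exact le_of_sq_le_sq this hr.le
  have hl0 : ∀ u, 0 ≤ l u := fun u => by
    have := hl01 u ⟨1, Or.inr rfl⟩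
    rw [one_mul] at this
    exact le_trans (by split_ifs <;> simp) this
  -- Since `sgn 0` disagrees with the label `1`, the loss at `0` is at least `1`.
  have hB : 0 < B := by
    have h1 := hl01 0 ⟨1, Or.inr rfl⟩
    have h2 := hlB 0 (by rw [abs_zero]; positivity)
    have h3 : sgn 0 ≠ ⟨1, Or.inr rfl⟩ := fun h => by
      rw [sgn, if_neg (lt_irrefl _)] at h
      have : (-1 : ℝ) = 1 := congrArg Subtype.val h
      norm_num at this
    rw [if_pos h3, mul_zero] at h1
    linarith [le_abs_self (l 0)]
  have hψ := measurable_inner_signedFeature (c := c) hφm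
  have hψr : ∀ (j : Fin c) z, ‖signedFeature φ j z‖ ≤ r := fun j z => by
    rw [norm_signedFeature]
    exact hφr _
  let U : Fin c → (Fin n → X × (Fin c → Label)) → ℝ := fun j =>
    uniformDeviation D (signedFeature φ j) l Λ
  have hUm : ∀ j, Measurable (U j) := fun j =>
    measurable_uniformDeviation D hl (hψ j) (hψr j) hΛ
  have hUb : ∀ j S, |U j S| ≤ _ := fun j S => abs_uniformDeviation_le D hΛ (hψr j) hlB S
  have havg : ∀ (a : Fin c → ℝ) (A : ℝ), (∀ j, |a j| ≤ A) → |1 / c * ∑ j, a j| ≤ A :=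
    fun a A ha => by
      rw [abs_mul, abs_of_nonneg (by positivity), one_div_mul_eq_div, div_le_iff₀ hc']
      refine (Finset.abs_sum_le_sum_abs _ _).trans
        ((Finset.sum_le_sum fun j _ => ha j).trans_eq ?_)
      simp [mul_comm]
  -- Concentration is applied once, to the average over labels, so no union bound over labels is
  -- paid.
  obtain ⟨E, hE, hPE, hES⟩ := exists_measurableSet_le_integral_add D hn hB hδ hδ1
    (f := fun S => 1 / c * ∑ j, U j S)
    ((Finset.measurable_sum _ fun j _ => hUm j).const_mul _)
    (fun S => havg _ _ fun j => hUb j S)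
    (fun S i z => by
      rw [← mul_sub, ← Finset.sum_sub_distrib]
      exact havg _ _ fun j => uniformDeviation_update_le D hΛ (hψr j) hl0 hlB S i z)
  have hmean : ∫ S, 1 / c * ∑ j, U j S ∂(Measure.pi fun _ : Fin n => D)
      ≤ 2 * (ρ * Λ * r * √n) / n := by
    rw [integral_const_mul, integral_finsetSum _ fun j _ => integrable_of_abs_le (hUm j) (hUb j),
      one_div_mul_eq_div, div_le_iff₀ hc']
    refine (Finset.sum_le_sum fun j _ => integral_uniformDeviation_le D hn hl (hψ j) hr.le
      (hψr j) hΛ).trans_eq ?_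
    simp [mul_comm]
  refine ⟨E, hE, hPE, ?_⟩
  rintro S hS _ ⟨W, hW, rfl⟩
  have hWj : ∀ j, ‖W j‖ ≤ Λ := fun j => by
    refine le_trans (Real.le_sqrt_of_sq_le ?_) hW
    exact Finset.single_le_sum (f := fun j => ‖W j‖ ^ 2) (fun j _ => sq_nonneg _)
      (Finset.mem_univ j)
  refine ⟨subsetRisk01_le_mul_hammingRisk01 D hc fun j => measurable_inner_featureMap hφm (W j), ?_⟩
  have hrisk := hammingRisk01_le_average_integral D (f := fun x j => ⟪W j, φ x⟫) hl01 fun j => by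
    simpa only [inner_signedFeature] using integrable_comp_inner D hl
      (measurable_inner_featureMap (hψ j)) (hψr j) (W j)
  have hdev : (1 / c * ∑ j, ∫ z, l ((z.2 j : ℝ) * ⟪W j, φ z.1⟫) ∂D : ℝ) ≤
      empiricalHammingRisk l S (fun x j => ⟪W j, φ x⟫) + 1 / c * ∑ j, U j S := by
    rw [empiricalHammingRisk_eq_average, ← mul_add, ← Finset.sum_add_distrib]
    refine mul_le_mul_of_nonneg_left (Finset.sum_le_sum fun j _ => ?_) (by positivity)
    have := integral_sub_average_le_uniformDeviation D hΛ (hψr j) hlB S (hWj j)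
    simp only [inner_signedFeature] at this
    linarith
  -- Scalar contraction label by label costs no factor `√2`; the stated constant has that slack.
  have hsqrt : 2 * (ρ * Λ * r * √n) / n ≤ 2 * √2 * ρ * √(Λ ^ 2 * r ^ 2 / n) := by
    have h1 : √(Λ ^ 2 * r ^ 2 / n) = Λ * r * √n / n := by
      rw [Real.sqrt_div (by positivity), ← mul_pow, Real.sqrt_sq (by positivity), mul_div_assoc _ √_,
        Real.sqrt_div_self, ← div_eq_mul_inv]
    have h2 : (1 : ℝ) ≤ √2 := Real.one_le_sqrt.2 one_le_two
    have h3 : 0 ≤ 2 * ρ * (Λ * r * √n / n) := by positivity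
    rw [h1]
    calc 2 * (ρ * Λ * r * √n) / n = 1 * (2 * ρ * (Λ * r * √n / n)) := by ring
      _ ≤ √2 * (2 * ρ * (Λ * r * √n / n)) := mul_le_mul_of_nonneg_right h2 h3
      _ = _ := by ring
  -- One one-sided deviation suffices, so the factor `3` and the `2` inside the logarithm are slack.
  have hconf : B * √(Real.log (1 / δ) / (2 * n)) ≤ 3 * B * √(Real.log (2 / δ) / (2 * n)) := by
    have h1 : √(Real.log (1 / δ) / (2 * n)) ≤ √(Real.log (2 / δ) / (2 * n)) := by
      gcongr
      norm_num
    have h2 := mul_le_mul_of_nonneg_left h1 hB.le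
    have h3 : 0 ≤ B * √(Real.log (2 / δ) / (2 * n)) := by positivity
    linarith
  have htotal : hammingRisk01 D (classifier fun x j => ⟪W j, φ x⟫) ≤
      empiricalHammingRisk l S (fun x j => ⟪W j, φ x⟫) + 2 * √2 * ρ * √(Λ ^ 2 * r ^ 2 / n)
        + 3 * B * √(Real.log (2 / δ) / (2 * n)) := by
    linarith [hES S hS]
  calc _ ≤ c * (empiricalHammingRisk l S (fun x j => ⟪W j, φ x⟫)
        + 2 * √2 * ρ * √(Λ ^ 2 * r ^ 2 / n) + 3 * B * √(Real.log (2 / δ) / (2 * n))) :=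
        mul_le_mul_of_nonneg_left htotal hc'.le
    _ = _ := by ring
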